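/- A left quasigroup is a set $Q$ with binary operations $*,\backslash$ satisfying $x*(x\backslash y)=y=x\backslash(x*y)$. A rack is a left quasigroup with $x*(y*z)=(x*y)*(x*z)$. It is connected if the group generated by all left translations $L_x\colon y\mapsto x*y$ acts transitively on it. It is medial if $(x*y)*(z*w)=(x*z)*(y*w)$ for all $x,y,z,w$. It is abelian (in the sense of commutator theory) if for every $n\ge 0$, every $(n+1)$-ary term $t$ in the operations $*,\backslash$ and all $a,b,u_1,\dots,u_n,v_1,\dots,v_n\in Q$, the equality $t(a,u_1,\dots,u_n)=t(a,v_1,\dots,v_n)$ implies $t(b,u_1,\dots,u_n)=t(b,v_1,\dots,v_n)$. Let $Q$ be a finite, nonempty, connected rack. Then the following are equivalent: 1. $Q$ is medial. 2. $Q$ is abelian. 3. There are an abelian group $A$, an automorphism $f$ of $A$ with $\mathrm{Fix}(f)=\{a\in A: f(a)=a\}=\{0\}$, and an integer $n\ge 1$ such that $Q\cong \mathrm{Aff}(A,1-f,f,0)\times(\mathbb{Z}_n,+1)$, the direct product of left quasigroups. Here $\mathrm{Aff}(A,1-f,f,0)$ is $A$ with $a*b=(1-f)(a)+f(b)$, and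 $(\mathbb{Z}_n,+1)$ is $\mathbb{Z}/n\mathbb{Z}$ with $a*b=b+1$. -/

import Mathlib

universe u v

/-- A left quasigroup: a set with two binary operations `x ⋆ y` (`op`) and `x \ y` (`ldiv`) with
`x ⋆ (x \ y) = y = x \ (x ⋆ y)`. -/
class LeftQuasigroup (Q : Type u) where
  op : Q → Q → Q
  ldiv : Q → Q → Q
  op_ldiv : ∀ x y : Q, op x (ldiv x y) = y
  ldiv_op : ∀ x y : Q, ldiv x (op x y) = y

/-- A rack (Mathlib's notion: `x ◃ (y ◃ z) = (x ◃ y) ◃ (x ◃ z)` with all left translations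
bijective) is a left quasigroup with `x ⋆ y = x ◃ y` and `x \ y = x ◃⁻¹ y`. -/
instance Rack.instLeftQuasigroup (Q : Type u) [Rack Q] : LeftQuasigroup Q where
  op := Shelf.act
  ldiv := Rack.invAct
  op_ldiv := fun x y => Rack.right_inv x y
  ldiv_op := fun x y => Rack.left_inv x y

namespace LeftQuasigroup

/-- The left translation `L_x : y ↦ x ⋆ y`, a permutation of `Q`. -/
def leftMul {Q : Type u} [LeftQuasigroup Q] (x : Q) : Equiv.Perm Q where
  toFun := op x
  invFun := ldiv x
  left_inv := ldiv_op x
  right_inv := op_ldiv x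

/-- The left multiplication group, generated by all left translations. -/
def LMlt (Q : Type u) [LeftQuasigroup Q] : Subgroup (Equiv.Perm Q) :=
  Subgroup.closure (Set.range (leftMul : Q → Equiv.Perm Q))

/-- `Q` is connected if its left multiplication group acts transitively on it. -/
def IsConnected (Q : Type u) [LeftQuasigroup Q] : Prop :=
  MulAction.IsPretransitive (LMlt Q) Q

/-- The medial law `(x ⋆ y) ⋆ (z ⋆ w) = (x ⋆ z) ⋆ (y ⋆ w)`. -/
def IsMedial (Q : Type u) [LeftQuasigroup Q] : Prop :=
  ∀ x y z w : Q, op (op x y) (op z w) = op (op x z) (op y w)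

/-- Terms in the language `{⋆, \}` of left quasigroups, with variables in `V`. -/
inductive LQTerm (V : Type) : Type where
  | var : V → LQTerm V
  | op : LQTerm V → LQTerm V → LQTerm V
  | ldiv : LQTerm V → LQTerm V → LQTerm V

/-- The value of a term at an assignment of the variables. -/
def LQTerm.eval {V : Type} {Q : Type u} [LeftQuasigroup Q] (val : V → Q) : LQTerm V → Q
  | .var i => val i
  | .op s t => LeftQuasigroup.op (s.eval val) (t.eval val)
  | .ldiv s t => LeftQuasigroup.ldiv (s.eval val) (t.eval val)

/-- `α` centralizes `β` over `δ`: the term condition `C(α, β; δ)` of commutator theory. -/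
def Centralizes {Q : Type u} [LeftQuasigroup Q] (α β δ : Setoid Q) : Prop :=
  ∀ (n : ℕ) (t : LQTerm (Fin (n + 1))) (a b : Q) (x y : Fin n → Q),
    α a b → (∀ i, β (x i) (y i)) →
      δ (t.eval (Fin.cons a x : Fin (n + 1) → Q)) (t.eval (Fin.cons a y : Fin (n + 1) → Q)) →
      δ (t.eval (Fin.cons b x : Fin (n + 1) → Q)) (t.eval (Fin.cons b y : Fin (n + 1) → Q))

/-- `Q` is abelian in the sense of commutator theory: `C(1_Q, 1_Q; 0_Q)`, where `1_Q` is the full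
congruence and `0_Q` is equality. -/
def IsAbelian (Q : Type u) [LeftQuasigroup Q] : Prop :=
  Centralizes (⊤ : Setoid Q) ⊤ ⊥

/-- The carrier of the affine left quasigroup `Aff(A, f, g, c)`. -/
@[nolint unusedArguments]
def Aff (A : Type u) [AddCommGroup A] (_f : A →+ A) (_g : A ≃+ A) (_c : A) : Type u := A

/-- `Aff(A, f, g, c)`: the operation `a ⋆ b = f a + g b + c` on an abelian group `A`. -/
instance Aff.instLeftQuasigroup (A : Type u) [AddCommGroup A] (f : A →+ A) (g : A ≃+ A)
    (c : A) : LeftQuasigroup (Aff A f g c) where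
  op := fun a b : A => (f a + g b + c : A)
  ldiv := fun a b : A => (g.symm (b - c - f a) : A)
  op_ldiv := fun (a b : A) => by
    change f a + g (g.symm (b - c - f a)) + c = b
    rw [AddEquiv.apply_symm_apply]; abel
  ldiv_op := fun (a b : A) => by
    change g.symm (f a + g b + c - c - f a) = b
    rw [AddEquiv.symm_apply_eq]; abel

/-- The carrier of the permutation left quasigroup `(S, θ)`. -/
@[nolint unusedArguments]
def PermLQ (S : Type u) (_θ : Equiv.Perm S) : Type u := S

/-- `(S, θ)`: the operation `a ⋆ b = θ b`. -/
instance PermLQ.instLeftQuasigroup (S : Type u) (θ : Equiv.Perm S) :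
    LeftQuasigroup (PermLQ S θ) where
  op := fun _ b : S => (θ b : S)
  ldiv := fun _ b : S => (θ.symm b : S)
  op_ldiv := fun (_ b : S) => θ.apply_symm_apply b
  ldiv_op := fun (_ b : S) => θ.symm_apply_apply b

/-- `(ℤ/n, +1)`: the operation `a ⋆ b = b + 1` on `ℤ/n`. -/
abbrev CyclicPermLQ (n : ℕ) : Type := PermLQ (ZMod n) (Equiv.addRight 1)

/-- The direct product, with componentwise operations. -/
instance instProd (Q : Type u) (R : Type v) [LeftQuasigroup Q] [LeftQuasigroup R] :
    LeftQuasigroup (Q × R) where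
  op := fun x y => (op x.1 y.1, op x.2 y.2)
  ldiv := fun x y => (ldiv x.1 y.1, ldiv x.2 y.2)
  op_ldiv := fun x y => Prod.ext (op_ldiv x.1 y.1) (op_ldiv x.2 y.2)
  ldiv_op := fun x y => Prod.ext (ldiv_op x.1 y.1) (ldiv_op x.2 y.2)

/-- Isomorphism of left quasigroups: a bijection preserving both operations. -/
def IsIsomorphic (Q : Type u) (R : Type v) [LeftQuasigroup Q] [LeftQuasigroup R] : Prop :=
  ∃ e : Q ≃ R, (∀ x y : Q, e (op x y) = op (e x) (e y)) ∧
    ∀ x y : Q, e (ldiv x y) = ldiv (e x) (e y)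

end LeftQuasigroup

namespace LeftQuasigroup

open Equiv

/-! ### Abelianness of the affine-by-cyclic products. -/

section TermCondition

/-! Fix `e` and let `D` be the group generated by the `L_x L_e⁻¹`. Mediality makes `D` abelian, and
conjugation by `L_e` is an automorphism `f` of it. Connectedness writes every `x` as `d (L_e^k e)`
with `d ∈ D`, so `L_x = d L_e d⁻¹` and `L_x L_e⁻¹ = d f(d)⁻¹`. Thus `1 - f` is onto `D`, hence
injective by finiteness: `f` has no nontrivial fixed point, `x` determines `d`, and `k` is
determined modulo the length `n` of the cycle of `e` under `L_e`. This identifies `Q` with `D ×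
ℤ/n`. Conversely, terms in such a product are affine, which gives the term condition; one instance
of that condition yields mediality. -/

instance Aff.instAddCommGroup (A : Type u) [AddCommGroup A] (f : A →+ A) (g : A ≃+ A) (c : A) :
    AddCommGroup (Aff A f g c) := inferInstanceAs (AddCommGroup A)

instance PermLQ.instAddCommGroup (S : Type u) [AddCommGroup S] (θ : Equiv.Perm S) :
    AddCommGroup (PermLQ S θ) := inferInstanceAs (AddCommGroup S)

/-- Changing one variable of a term in `Aff(A, 1 - f, f, 0) × (ℤ/n, +1)` shifts the value by an
amount that does not depend on the other variables. -/
theorem eval_sub_eval_aff_prod {A : Type u} [AddCommGroup A] (f : A ≃+ A) (n m : ℕ)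
    (t : LQTerm (Fin (m + 1)))
    (a b : Aff A (AddMonoidHom.id A - f.toAddMonoidHom) f 0 × CyclicPermLQ n)
    (x y : Fin m → Aff A (AddMonoidHom.id A - f.toAddMonoidHom) f 0 × CyclicPermLQ n) :
    ((t.eval (Fin.cons a x : Fin (m + 1) → _)).1 - (t.eval (Fin.cons a y : Fin (m + 1) → _)).1)
        = ((t.eval (Fin.cons b x : Fin (m + 1) → _)).1
          - (t.eval (Fin.cons b y : Fin (m + 1) → _)).1) ∧
      ((t.eval (Fin.cons a x : Fin (m + 1) → _)).2
          - (t.eval (Fin.cons a y : Fin (m + 1) → _)).2)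
        = ((t.eval (Fin.cons b x : Fin (m + 1) → _)).2
          - (t.eval (Fin.cons b y : Fin (m + 1) → _)).2) := by
  have op_sub : ∀ p q p' q' : A,
      ((p - f p) + f q + 0) - ((p' - f p') + f q' + 0) = (p - p') - f (p - p') + f (q - q') := by
    intro p q p' q'
    simp only [map_sub]; abel
  have ldiv_sub : ∀ p q p' q' : A,
      f.symm (q - 0 - (p - f p)) - f.symm (q' - 0 - (p' - f p'))
        = f.symm ((q - q') - ((p - p') - f (p - p'))) := by
    intro p q p' q'
    rw [← map_sub]; congr 1
    simp only [map_sub]; abel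
  induction t with
  | var i =>
    refine Fin.cases ?_ (fun j => ?_) i
    · simp only [LQTerm.eval, Fin.cons_zero, sub_self, and_self]
    · simp only [LQTerm.eval, Fin.cons_succ, and_self]
  | op s t hs ht =>
    refine ⟨(op_sub _ _ _ _).trans (Eq.trans ?_ (op_sub _ _ _ _).symm),
      (add_sub_add_right_eq_sub (G := ZMod n) _ _ 1).trans
        (ht.2.trans (add_sub_add_right_eq_sub (G := ZMod n) _ _ 1).symm)⟩
    exact congrArg₂ (fun u v : A => u - f u + f v) hs.1 ht.1
  | ldiv s t hs ht =>
    have shift : ∀ p q : ZMod n, (Equiv.addRight 1).symm p - (Equiv.addRight 1).symm q = p - q := by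
      intro p q
      simp [Equiv.addRight]
    refine ⟨(ldiv_sub _ _ _ _).trans (Eq.trans ?_ (ldiv_sub _ _ _ _).symm),
      (shift _ _).trans (ht.2.trans (shift _ _).symm)⟩
    exact congrArg₂ (fun u v : A => f.symm (v - (u - f u))) hs.1 ht.1

theorem isAbelian_aff_prod {A : Type u} [AddCommGroup A] (f : A ≃+ A) (n : ℕ) :
    IsAbelian (Aff A (AddMonoidHom.id A - f.toAddMonoidHom) f 0 × CyclicPermLQ n) := by
  intro m t a b x y _ _ h
  obtain ⟨h₁, h₂⟩ := eval_sub_eval_aff_prod f n m t a b x y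
  have h' := Prod.ext_iff.1 (show _ = _ from h)
  exact Prod.ext
    (sub_eq_zero.1 (h₁.symm.trans (sub_eq_zero.2 h'.1)))
    (sub_eq_zero.1 (h₂.symm.trans (sub_eq_zero.2 h'.2)))

theorem map_eval {Q : Type u} {R : Type v} [LeftQuasigroup Q] [LeftQuasigroup R] (e : Q → R)
    (hop : ∀ x y, e (op x y) = op (e x) (e y)) (hld : ∀ x y, e (ldiv x y) = ldiv (e x) (e y))
    {V : Type} (t : LQTerm V) (x : V → Q) : e (t.eval x) = t.eval (e ∘ x) := by
  induction t with
  | var i => rfl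
  | op s t hs ht => rw [LQTerm.eval, hop, hs, ht]; rfl
  | ldiv s t hs ht => rw [LQTerm.eval, hld, hs, ht]; rfl

theorem IsAbelian.of_isIsomorphic {Q : Type u} {R : Type v} [LeftQuasigroup Q] [LeftQuasigroup R]
    (hR : IsAbelian R) (h : IsIsomorphic Q R) : IsAbelian Q := by
  obtain ⟨e, hop, hld⟩ := h
  intro m t a b x y _ _ hxy
  have key : ∀ (c : Q) (z : Fin m → Q), e (t.eval (Fin.cons c z : Fin (m + 1) → Q))
      = t.eval (Fin.cons (e c) (e ∘ z) : Fin (m + 1) → R) := by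
    intro c z
    rw [map_eval e hop hld]
    congr 1
    funext i
    refine Fin.cases ?_ (fun j => ?_) i <;> simp
  have hxy' : t.eval (Fin.cons a x : Fin (m + 1) → Q) = t.eval (Fin.cons a y : Fin (m + 1) → Q) :=
    hxy
  apply e.injective
  rw [key, key]
  refine hR m t (e a) (e b) (e ∘ x) (e ∘ y) trivial (fun _ => trivial) ?_
  change t.eval _ = t.eval _
  rw [← key, ← key, hxy']

end TermCondition

/-! ### Left translations and the displacement group. -/

section Displacement

variable {Q : Type u} [Rack Q]

theorem leftMul_apply (x y : Q) : leftMul x y = op x y := rfl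

theorem leftMul_op (x y : Q) : leftMul (op x y) = leftMul x * leftMul y * (leftMul x)⁻¹ := by
  rw [eq_mul_inv_iff_mul_eq]
  ext z
  exact (Shelf.self_distrib (x := x) (y := y) (z := z)).symm

theorem leftMul_apply_of_mem {g : Perm Q} (hg : g ∈ LMlt Q) (x : Q) :
    leftMul (g x) = g * leftMul x * g⁻¹ := by
  induction hg using Subgroup.closure_induction generalizing x with
  | mem g hg =>
    obtain ⟨y, rfl⟩ := hg
    exact leftMul_op y x
  | one => simp
  | mul g h _ _ hg hh => rw [Perm.mul_apply, hg, hh]; group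
  | inv g _ hg =>
    have := hg (g⁻¹ x)
    rw [show g (g⁻¹ x) = x from g.apply_symm_apply x] at this
    rw [this]; group

/-- Mediality reads `L_{x⋆y} L_z = L_{x⋆z} L_y`; expand `L_{x⋆y} = L_x L_y L_x⁻¹` and cancel `L_x`.
-/
theorem isMedial_iff_leftMul :
    IsMedial Q ↔ ∀ x y z : Q,
      leftMul y * (leftMul x)⁻¹ * leftMul z = leftMul z * (leftMul x)⁻¹ * leftMul y := by
  have key : ∀ x y z : Q, leftMul (op x y) * leftMul z
      = leftMul x * (leftMul y * (leftMul x)⁻¹ * leftMul z) := by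
    intro x y z
    rw [leftMul_op]; group
  constructor
  · intro h x y z
    apply mul_left_cancel (a := leftMul x)
    rw [← key, ← key]
    ext w
    exact h x y z w
  · intro h x y z w
    have := key x y z
    rw [h, ← key] at this
    exact congrArg (fun g : Perm Q => g w) this

theorem IsAbelian.isMedial (h : IsAbelian Q) : IsMedial Q := by
  rw [isMedial_iff_leftMul]
  intro x y z
  ext w
  let v : Fin 4 → LQTerm (Fin (3 + 1)) := LQTerm.var
  have key : ldiv z (op x (ldiv y (op z (ldiv x (op y w)))))
      = ldiv x (op x (ldiv y (op x (ldiv x (op y w))))) :=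
    -- The term is `L_z⁻¹ L_x L_y⁻¹ L_z L_x⁻¹ L_y w`, with `y` in slot 0. It collapses to `w` when
    -- `y = x` and also when `z = x`.
    h 3 (.ldiv (v 1) (.op (v 2) (.ldiv (v 0) (.op (v 1) (.ldiv (v 2) (.op (v 0) (v 3)))))))
      x y ![z, x, w] ![x, x, w] trivial (fun _ => trivial)
      (show ldiv z (op x (ldiv x (op z (ldiv x (op x w)))))
        = ldiv x (op x (ldiv x (op x (ldiv x (op x w))))) by simp only [op_ldiv, ldiv_op])
  simp only [op_ldiv, ldiv_op] at key
  have := congrArg (fun u => op y (ldiv x (op z u))) key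
  simp only [op_ldiv, ldiv_op] at this
  exact this.symm

variable (Q) in
/-- The subgroup generated by the permutations `L_x L_e⁻¹`. -/
def displacement (e : Q) : Subgroup (Perm Q) :=
  Subgroup.closure (Set.range fun x : Q => leftMul x * (leftMul e)⁻¹)

variable {e : Q}

theorem mul_inv_mem_displacement (e x : Q) : leftMul x * (leftMul e)⁻¹ ∈ displacement Q e :=
  Subgroup.subset_closure ⟨x, rfl⟩

theorem leftMul_mem_LMlt (x : Q) : leftMul x ∈ LMlt Q := Subgroup.subset_closure ⟨x, rfl⟩

theorem displacement_le_LMlt : displacement Q e ≤ LMlt Q := by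
  rw [displacement, Subgroup.closure_le]
  rintro _ ⟨x, rfl⟩
  exact mul_mem (leftMul_mem_LMlt x) (inv_mem (leftMul_mem_LMlt e))

theorem leftMul_mem_normalizer_displacement :
    leftMul e ∈ Subgroup.normalizer (displacement Q e : Set (Perm Q)) := by
  -- If `g` commutes with `L_e`, conjugation by `g` sends `L_x L_e⁻¹` to `L_{g x} L_e⁻¹`.
  have conj : ∀ g ∈ LMlt Q, g * leftMul e = leftMul e * g →
      ∀ d ∈ displacement Q e, g * d * g⁻¹ ∈ displacement Q e := by
    intro g hg hc d hd
    induction hd using Subgroup.closure_induction with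
    | mem d hd =>
      obtain ⟨x, rfl⟩ := hd
      have : g * (leftMul x * (leftMul e)⁻¹) * g⁻¹ = leftMul (g x) * (leftMul e)⁻¹ := by
        have : (leftMul e)⁻¹ * g⁻¹ = g⁻¹ * (leftMul e)⁻¹ := by
          rw [← mul_inv_rev, ← mul_inv_rev, hc]
        rw [leftMul_apply_of_mem hg, mul_assoc, mul_assoc, this]; group
      exact this ▸ mul_inv_mem_displacement e (g x)
    | one => simp
    | mul a b _ _ ha hb => simpa [mul_assoc] using mul_mem ha hb
    | inv a _ ha => simpa [mul_assoc] using inv_mem ha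
  rw [Subgroup.mem_normalizer_iff]
  refine fun d => ⟨conj _ (leftMul_mem_LMlt e) rfl d, fun hd => ?_⟩
  have := conj _ (inv_mem (leftMul_mem_LMlt e)) (by group) _ hd
  simpa [mul_assoc] using this

theorem conj_zpow_mem_displacement {d : Perm Q} (hd : d ∈ displacement Q e) (k : ℤ) :
    leftMul e ^ k * d * (leftMul e ^ k)⁻¹ ∈ displacement Q e :=
  (Subgroup.mem_normalizer_iff.1 (zpow_mem leftMul_mem_normalizer_displacement k) d).1 hd

theorem exists_eq_mul_zpow_of_mem_LMlt (e : Q) {g : Perm Q} (hg : g ∈ LMlt Q) :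
    ∃ d ∈ displacement Q e, ∃ k : ℤ, g = d * leftMul e ^ k := by
  induction hg using Subgroup.closure_induction with
  | mem g hg =>
    obtain ⟨x, rfl⟩ := hg
    exact ⟨_, mul_inv_mem_displacement e x, 1, by group⟩
  | one => exact ⟨1, one_mem _, 0, by simp⟩
  | mul g h _ _ hg hh =>
    obtain ⟨d, hd, k, rfl⟩ := hg
    obtain ⟨c, hc, l, rfl⟩ := hh
    refine ⟨_, mul_mem hd (conj_zpow_mem_displacement hc k), k + l, ?_⟩
    rw [zpow_add]; group
  | inv g _ hg =>
    obtain ⟨d, hd, k, rfl⟩ := hg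
    refine ⟨_, conj_zpow_mem_displacement (inv_mem hd) (-k), -k, ?_⟩
    group

theorem IsConnected.exists_eq_apply (hQ : IsConnected Q) (e x : Q) :
    ∃ d ∈ displacement Q e, ∃ k : ℤ, x = d ((leftMul e ^ k) e) := by
  obtain ⟨⟨g, hg⟩, h⟩ := hQ.exists_smul_eq e x
  obtain ⟨d, hd, k, rfl⟩ := exists_eq_mul_zpow_of_mem_LMlt e hg
  exact ⟨d, hd, k, h.symm⟩

theorem leftMul_apply_zpow {d : Perm Q} (hd : d ∈ displacement Q e) (k : ℤ) :
    leftMul (d ((leftMul e ^ k) e)) = d * leftMul e * d⁻¹ := by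
  rw [leftMul_apply_of_mem (displacement_le_LMlt hd),
    leftMul_apply_of_mem (zpow_mem (leftMul_mem_LMlt e) k)]
  group

theorem IsMedial.displacement_mul_comm (h : IsMedial Q) (e : Q) :
    ∀ a b : displacement Q e, a * b = b * a := by
  rw [isMedial_iff_leftMul] at h
  have hcomm : ∀ a ∈ Set.range (fun x : Q => leftMul x * (leftMul e)⁻¹),
      ∀ b ∈ Set.range (fun x : Q => leftMul x * (leftMul e)⁻¹), a * b = b * a := by
    rintro _ ⟨x, rfl⟩ _ ⟨y, rfl⟩
    simpa [mul_assoc] using congrArg (· * (leftMul e)⁻¹) (h e x y)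
  exact (Subgroup.isMulCommutative_closure hcomm).is_comm.comm

/-- Conjugation by `L_e` on the displacement group. -/
def displacementConj (e : Q) : displacement Q e ≃* displacement Q e where
  toFun d := ⟨leftMul e * d * (leftMul e)⁻¹, by
    simpa using conj_zpow_mem_displacement d.2 1⟩
  invFun d := ⟨(leftMul e)⁻¹ * d * leftMul e, by
    simpa using conj_zpow_mem_displacement d.2 (-1)⟩
  left_inv d := by ext1; simp [mul_assoc]
  right_inv d := by ext1; simp [mul_assoc]
  map_mul' a b := by ext1; simp [mul_assoc]

theorem coe_displacementConj (d : displacement Q e) :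
    (displacementConj e d : Perm Q) = leftMul e * d * (leftMul e)⁻¹ := rfl

/-- Commutativity makes `c ↦ c f(c)⁻¹` a homomorphism, so it suffices to reach the generators `L_x
L_e⁻¹`. -/
theorem exists_mul_inv_displacementConj (hQ : IsConnected Q)
    (hc : ∀ a b : displacement Q e, a * b = b * a) (d : displacement Q e) :
    ∃ c, c * (displacementConj e c)⁻¹ = d := by
  let _ : CommGroup (displacement Q e) := { mul_comm := hc }
  obtain ⟨d, hd⟩ := d
  induction hd using Subgroup.closure_induction with
  | mem d hd =>
    obtain ⟨x, rfl⟩ := hd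
    obtain ⟨c, hc, k, rfl⟩ := hQ.exists_eq_apply e x
    refine ⟨⟨c, hc⟩, Subtype.ext ?_⟩
    simp [leftMul_apply_zpow hc, coe_displacementConj, mul_assoc]
  | one => exact ⟨1, by simp; rfl⟩
  | mul a b _ _ ha hb =>
    obtain ⟨a', ha'⟩ := ha
    obtain ⟨b', hb'⟩ := hb
    refine ⟨a' * b', ?_⟩
    rw [map_mul, mul_inv, mul_mul_mul_comm, ha', hb']; rfl
  | inv a _ ha =>
    obtain ⟨a', ha'⟩ := ha
    refine ⟨a'⁻¹, ?_⟩
    rw [map_inv, ← mul_inv, ha']; rfl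

/-! ### Product decomposition of a connected medial rack. -/

theorem zpow_apply_eq_iff {X : Type*} (g : Perm X) (x : X) (i j : ℤ) :
    (g ^ i) x = (g ^ j) x ↔
      (i : ZMod (MulAction.period g x)) = (j : ZMod (MulAction.period g x)) := by
  rw [ZMod.intCast_eq_intCast_iff_dvd_sub, ← MulAction.zpow_smul_eq_iff_period_dvd,
    sub_eq_neg_add, zpow_add, mul_smul, zpow_neg, inv_smul_eq_iff]
  exact eq_comm

theorem IsMedial.exists_isIsomorphic [Finite Q] [Nonempty Q] (hQ : IsConnected Q)
    (hm : IsMedial Q) :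
    ∃ (A : Type u) (_ : AddCommGroup A) (f : A ≃+ A) (n : ℕ),
      0 < n ∧ Function.fixedPoints f = {0} ∧
        IsIsomorphic Q (Aff A (AddMonoidHom.id A - f.toAddMonoidHom) f 0 × CyclicPermLQ n) := by
  obtain ⟨e⟩ := ‹Nonempty Q›
  have hc := hm.displacement_mul_comm e
  let _ : CommGroup (displacement Q e) := { mul_comm := hc }
  let D := displacement Q e
  have inj : Function.Injective fun c : D => c * (displacementConj e c)⁻¹ :=
    Finite.injective_iff_surjective.2 (exists_mul_inv_displacementConj hQ hc)
  let n := MulAction.period (leftMul e) e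
  let F : D × ZMod n → Q := fun p => (p.1 : Perm Q) ((leftMul e ^ (p.2.cast : ℤ)) e)
  have F_cast : ∀ (d : D) (k : ℤ), F (d, (k : ZMod n)) = (d : Perm Q) ((leftMul e ^ k) e) := by
    intro d k
    refine congrArg (d : Perm Q) ((zpow_apply_eq_iff _ _ _ _).2 ?_)
    exact ZMod.intCast_zmod_cast _
  have F_bij : Function.Bijective F := by
    constructor
    · rintro ⟨c, k⟩ ⟨d, l⟩ h
      -- `L_{F(c, k)} = c L_e c⁻¹` does not depend on `k`, so it recovers `c f(c)⁻¹`, hence `c`.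
      have hL := congrArg leftMul h
      simp only [F] at hL
      rw [leftMul_apply_zpow c.2, leftMul_apply_zpow d.2] at hL
      obtain rfl : c = d := inj <| Subtype.ext <| by
        simpa [coe_displacementConj, mul_assoc] using congrArg (· * (leftMul e)⁻¹) hL
      have hk := (zpow_apply_eq_iff _ _ _ _).1 ((c : Perm Q).injective h)
      exact congrArg (Prod.mk c)
        ((ZMod.intCast_zmod_cast k).symm.trans (hk.trans (ZMod.intCast_zmod_cast l)))
    · intro x
      obtain ⟨d, hd, k, rfl⟩ := hQ.exists_eq_apply e x
      exact ⟨(⟨d, hd⟩, k), F_cast _ _⟩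
  -- `c L_e c⁻¹ · d L_e^l = c f(c)⁻¹ f(d) · L_e^(l+1)`.
  have F_op : ∀ p q : D × ZMod n,
      F (p.1 * (displacementConj e p.1)⁻¹ * displacementConj e q.1, q.2 + 1) = op (F p) (F q) := by
    rintro ⟨c, k⟩ ⟨d, l⟩
    obtain ⟨l, rfl⟩ := ZMod.intCast_surjective l
    have : (l : ZMod n) + 1 = ((l + 1 : ℤ) : ZMod n) := by push_cast; rfl
    rw [this, F_cast, F_cast, ← leftMul_apply]
    simp only [F]
    rw [leftMul_apply_zpow c.2, add_comm, zpow_add]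
    simp [coe_displacementConj]
  let f : Additive D ≃+ Additive D := MulEquiv.toAdditive (displacementConj e)
  let E : Aff (Additive D) (AddMonoidHom.id _ - f.toAddMonoidHom) f 0 × CyclicPermLQ n ≃ Q :=
    Equiv.ofBijective F F_bij
  have E_op : ∀ p q, E (op p q) = op (E p) (E q) := by
    intro p q
    have h : ∀ c d : D, Additive.toMul ((AddMonoidHom.id (Additive D) - f.toAddMonoidHom)
        (Additive.ofMul c) + f (Additive.ofMul d) + 0)
        = c * (displacementConj e c)⁻¹ * displacementConj e d := by
      intro c d
      simp [f, div_eq_mul_inv]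
    exact (congrArg (fun a : D => F (a, Equiv.addRight (1 : ZMod n) q.2)) (h p.1 q.1)).trans
      (F_op p q)
  have symm_op : ∀ x y, E.symm (op x y) = op (E.symm x) (E.symm y) := by
    intro x y
    rw [Equiv.symm_apply_eq, E_op, E.apply_symm_apply, E.apply_symm_apply]
  refine ⟨Additive D, inferInstance, f, n, ?_, ?_, E.symm, symm_op, fun x y => ?_⟩
  · exact MulAction.period_pos_of_orderOf_pos (orderOf_pos _) _
  · ext d
    rw [Function.mem_fixedPoints, Set.mem_singleton_iff]
    refine ⟨fun h => inj (a₁ := Additive.toMul d) (a₂ := 1) ?_, fun h => h ▸ map_zero f⟩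
    have h' : displacementConj e (Additive.toMul d) = Additive.toMul d := h
    simp [h']
  · rw [← ldiv_op (E.symm x) (E.symm (ldiv x y)), ← symm_op, op_ldiv]

end Displacement
end LeftQuasigroup

theorem mainTheorem6 (Q : Type u) [Rack Q] [Finite Q] [Nonempty Q]
    (hQ : LeftQuasigroup.IsConnected Q) :
    List.TFAE [
      LeftQuasigroup.IsMedial Q,
      LeftQuasigroup.IsAbelian Q,
      ∃ (A : Type u) (_ : AddCommGroup A) (f : A ≃+ A) (n : ℕ),
        0 < n ∧ Function.fixedPoints f = {0} ∧
        LeftQuasigroup.IsIsomorphic Q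
          (LeftQuasigroup.Aff A (AddMonoidHom.id A - f.toAddMonoidHom) f 0 ×
            LeftQuasigroup.CyclicPermLQ n)] := by
  tfae_have 1 → 3 := LeftQuasigroup.IsMedial.exists_isIsomorphic hQ
  tfae_have 3 → 2 := by
    rintro ⟨A, _, f, n, _, _, h⟩
    exact (LeftQuasigroup.isAbelian_aff_prod f n).of_isIsomorphic h
  tfae_have 2 → 1 := LeftQuasigroup.IsAbelian.isMedial
  tfae_finish
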